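/- Let $n\ge 1$ be an integer, let $K,M>0$, $M_1\ge 0$ and $0<a\le \frac{K}{M(1+nM_1)}$ be real numbers, and let $f:[-K,K]^n\to[-M,M]^n$ be a vector field. For a constant $c$, let $\mathbf I[-c,c]^m$ be the set of non-empty compact hyper-rectangles contained in $[-c,c]^m$, ordered by reverse inclusion. For a hyper-rectangle or interval matrix $\alpha$ let $w(\alpha)$ be the largest width of its components; for an interval matrix $A$ let $\|A\|_\infty=\max_i\sum_j\|A_{ij}\|$, where $\|[s,t]\|=\max(|s|,|t|)$. For $g:[-K,K]^n\to\mathbb R$ and $x\in[-K,K]^n$ let $\overline L(g)(x)$ be the intersection of all hyper-rectangles $b$ such that, for some relatively open $O\ni x$ in $[-K,K]^n$, $g(y)-g(z)\in\{\langle v,y-z\rangle: v\in b\}$ for all $y,z\in O$ (and $\overline L(g)(x)=\mathbb R^n$ if there is no such $b$). For $f=(f_1,\dots,f_n)$, $\overline L(f)(x)$ is the interval matrix with rows $\overline L(f_i)(x)$. Let $u:\mathbf I[-K,K]^n\to \mathbf I[-M,M]^n$ and $u':\mathbf I[-K,K]^n\to \mathbf I[-M_1,M_1]^{n\times n}$ be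 Scott continuous interval extensions of $f$ and of $\overline L(f)$, i.e. $u(\{x\})=\{f(x)\}$ and $u'(\{x\})=\overline L(f)(x)$ for all $x\in[-K,K]^n$, such that $$w(u(\alpha))\le\|u'(\alpha)\|_\infty\, w(\alpha)\qquad\text{for all }\alpha\in\mathbf I[-K,K]^n .$$ For a partition $Q=(q_0,\dots,q_k)$, $0=q_0<\dots<q_k=a$, $k\ge1$, put $\Delta_j=q_{j+1}-q_j$ and $|Q|=\max_j\Delta_j$. The second-order Euler enclosure $y=E^2_{(u,u')}(Q):[0,a]\to\mathbf I[-K,K]^n$ is given by $y(0)=\{0\}$ and, for $q_j<x\le q_{j+1}$, $$y(x)=T_K\Big[y(q_j)+\int_{q_j}^x u(y(q_j))+(t-q_j)\,(u'\cdot u)\big(T_K(y(q_j)\oplus M\Delta_j)\big)\,dt\Big],$$ in interval arithmetic, where $(u'\cdot u)(\alpha)$ is the product of the interval matrix $u'(\alpha)$ with the interval vector $u(\alpha)$, $\oplus\, r$ enlarges every component by $r$ on both sides, and $T_K(X)=X\cap[-K,K]^n$ (the truncations have no effect when $|Q|\le 1$). **Theorem (second-order convergence).** If $u'$ is interval Lipschitz,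 that is, for some $\Lambda\ge0$ we have $w(u'(\alpha))\le\Lambda\, w(\alpha)$ for all $\alpha\in\mathbf I[-K,K]^n$, then $E^2$ converges with second order: there is a constant $C\ge 0$ such that, for every partition $Q$ of $[0,a]$ with $|Q|\le 1$, $$w\big(E^2_{(u,u')}(Q)\big)=\sup_{x\in[0,a]}w\big(E^2_{(u,u')}(Q)(x)\big)\le C\,|Q|^2 .$$ -/

import Mathlib

/-! ## Interval vectors and interval arithmetic

A compact interval `[lo, hi]` with `lo ≤ hi` is an element of Mathlib's `NonemptyInterval ℝ`
(`fst` is the lower end-point and `snd` the upper one). A hyper-rectangle of `ℝ^ι` is a family of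
such intervals indexed by `ι`; an interval `n × n` matrix is one indexed by `Fin n × Fin n`. -/

/-- Hyper-rectangles (interval vectors) of `ℝ^ι`. -/
abbrev IntervalBox (ι : Type) : Type := ι → NonemptyInterval ℝ

/-- The set of points of a hyper-rectangle. -/
def boxSet {ι : Type} (α : IntervalBox ι) : Set (ι → ℝ) :=
  {v | ∀ i, (α i).fst ≤ v i ∧ v i ≤ (α i).snd}

/-- The interval product `I · J = {s * t : s ∈ I, t ∈ J}`, through the four end-point products. -/
noncomputable def intervalMul (I J : NonemptyInterval ℝ) : NonemptyInterval ℝ where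
  fst := min (min (I.fst * J.fst) (I.fst * J.snd)) (min (I.snd * J.fst) (I.snd * J.snd))
  snd := max (max (I.fst * J.fst) (I.fst * J.snd)) (max (I.snd * J.fst) (I.snd * J.snd))
  fst_le_snd := ((min_le_left _ _).trans (min_le_left _ _)).trans
    ((le_max_left _ _).trans (le_max_left _ _))

/-- The multiple `r · I = {r * s : s ∈ I}` of an interval by a real number. -/
noncomputable def intervalScale (r : ℝ) (I : NonemptyInterval ℝ) : NonemptyInterval ℝ :=
  intervalMul (NonemptyInterval.pure r) I

/-- The product of an interval matrix and an interval vector. -/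
noncomputable def intervalMulVec {n : ℕ} (A : IntervalBox (Fin n × Fin n))
    (v : IntervalBox (Fin n)) : IntervalBox (Fin n) :=
  fun i => ∑ j, intervalMul (A (i, j)) (v j)

/-- The integral over `[p, x]`, `p ≤ x`, of an interval-valued function with integrable
end-points: the interval between the integrals of the lower and of the upper end-point.
(Under these conditions the `min` is the first and the `max` the second integral.) -/
noncomputable def intervalValuedIntegral (g : ℝ → NonemptyInterval ℝ) (p x : ℝ) :
    NonemptyInterval ℝ where
  fst := min (∫ t in p..x, (g t).fst) (∫ t in p..x, (g t).snd)
  snd := max (∫ t in p..x, (g t).fst) (∫ t in p..x, (g t).snd)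
  fst_le_snd := min_le_max

/-- The symmetric expansion of a hyper-rectangle by `r ≥ 0`: every `[lo, hi]` becomes
`[lo - r, hi + r]`. -/
noncomputable def symExpand {ι : Type} (α : IntervalBox ι) (r : ℝ) : IntervalBox ι :=
  fun i =>
    { fst := (α i).fst - |r|
      snd := (α i).snd + |r|
      fst_le_snd := by
        have h := (α i).fst_le_snd
        have h' := abs_nonneg r
        linarith }

/-- The width of an interval vector or matrix: the largest width of its components. -/
noncomputable def boxWidth {ι : Type} (α : IntervalBox ι) : ℝ :=
  ⨆ i, ((α i).snd - (α i).fst)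

/-- The norm `‖[lo, hi]‖ = max |lo| |hi|` of an interval. -/
noncomputable def intervalNorm (I : NonemptyInterval ℝ) : ℝ := max |I.fst| |I.snd|

/-- The norm `‖A‖_∞` of an interval matrix: the largest row sum of the norms of the entries. -/
noncomputable def matrixNormInf {n : ℕ} (A : IntervalBox (Fin n × Fin n)) : ℝ :=
  ⨆ i : Fin n, ∑ j : Fin n, intervalNorm (A (i, j))

/-! ## The interval domain of a cube -/

/-- The cube `[-K, K]^ι`. -/
def cube (ι : Type) (K : ℝ) : Set (ι → ℝ) := {x | ∀ i, -K ≤ x i ∧ x i ≤ K}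

/-- The interval domain `I[-K, K]^ι` of the hyper-rectangles contained in `[-K, K]^ι`. -/
@[ext]
structure BoxDom (ι : Type) (K : ℝ) where
  box : IntervalBox ι
  mem_cube : ∀ i, -K ≤ (box i).fst ∧ (box i).snd ≤ K

/-- The information order `α ⊑ β`, written `α ≤ β`, is reverse inclusion: the order of
`IntervalBox ι` is inclusion. -/
instance BoxDom.instPartialOrder (ι : Type) (K : ℝ) : PartialOrder (BoxDom ι K) :=
  PartialOrder.lift (fun α => OrderDual.toDual α.box) fun _ _ h => BoxDom.ext h

/-- The maximal element `{x}` for a point `x` of the cube. -/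
def BoxDom.single {ι : Type} {K : ℝ} (x : ι → ℝ) (hx : x ∈ cube ι K) : BoxDom ι K :=
  ⟨fun i => NonemptyInterval.pure (x i), hx⟩

/-- The truncation `α ↦ α ∩ [-K, K]^ι` (for `α` meeting the cube): end-points are clamped. -/
noncomputable def truncBox {ι : Type} {K : ℝ} (hK : 0 < K) (α : IntervalBox ι) : BoxDom ι K where
  box := fun i =>
    { fst := max (-K) (min K (α i).fst)
      snd := max (-K) (min K (α i).snd)
      fst_le_snd := max_le_max le_rfl (min_le_min le_rfl (α i).fst_le_snd) }
  mem_cube := fun _ => ⟨le_max_left _ _, max_le (by linarith) (min_le_left _ _)⟩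

/-- `u` is interval Lipschitz with constant `Λ`. -/
def IntervalLipschitzWith {ι κ : Type} {K M : ℝ} (Λ : ℝ) (u : BoxDom ι K → BoxDom κ M) : Prop :=
  ∀ α : BoxDom ι K, boxWidth (u α).box ≤ Λ * boxWidth α.box

/-- The hyper-rectangular closure of a set: the intersection of all hyper-rectangles that
contain it (the whole space if there is none). -/
def rectHull {κ : Type} (S : Set (κ → ℝ)) : Set (κ → ℝ) :=
  ⋂ b ∈ {b : IntervalBox κ | S ⊆ boxSet b}, boxSet b

/-- `u` is an interval extension of the set-valued map `F` on the cube: `u({x})` is the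
hyper-rectangular closure of `F x`. -/
def IsIntervalExtension {ι κ : Type} {K M : ℝ} (u : BoxDom ι K → BoxDom κ M)
    (F : (ι → ℝ) → Set (κ → ℝ)) : Prop :=
  ∀ (x : ι → ℝ) (hx : x ∈ cube ι K), boxSet (u (BoxDom.single x hx)).box = rectHull (F x)

/-! ## The domain-theoretic derivative with hyper-rectangular values -/

/-- The function `g` on `X` belongs to the single-step tie of `O ⊆ X` and `b`: for all `x, y ∈ O`
the difference `g x - g y` lies in `b (x - y) = {⟨v, x - y⟩ : v ∈ b}`. -/
def InTie {n : ℕ} (g : (Fin n → ℝ) → ℝ) (O : Set (Fin n → ℝ)) (b : IntervalBox (Fin n)) : Prop :=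
  ∀ x ∈ O, ∀ y ∈ O, ∃ v ∈ boxSet b, g x - g y = ∑ j, v j * (x j - y j)

/-- The value at `x ∈ X` of the derivative of `g : X → ℝ`, i.e. of the supremum (intersection)
of the single-step functions `b χ_O` with `O` open in `X` and `g` in the tie of `O` and `b`. It is
the whole space, the bottom element, if there is no such `b` with `x ∈ O`. -/
def LbarScalar {n : ℕ} (X : Set (Fin n → ℝ)) (g : (Fin n → ℝ) → ℝ) (x : Fin n → ℝ) :
    Set (Fin n → ℝ) :=
  ⋂ b ∈ {b : IntervalBox (Fin n) | ∃ V : Set (Fin n → ℝ), IsOpen V ∧ x ∈ V ∧ InTie g (V ∩ X) b},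
    boxSet b

/-- The derivative of a vector valued function, row by row, as a set of matrices. -/
def Lbar {n m : ℕ} (X : Set (Fin n → ℝ)) (f : (Fin n → ℝ) → (Fin m → ℝ)) (x : Fin n → ℝ) :
    Set (Fin m × Fin n → ℝ) :=
  {A | ∀ i, (fun j => A (i, j)) ∈ LbarScalar X (fun z => f z i) x}

/-! ## Partitions and the second-order Euler operator -/

/-- A partition `0 = q_0 < ⋯ < q_k = a` of `[0, a]`, with `k ≥ 1`. -/
structure IntervalPartition (a : ℝ) where
  k : ℕ
  one_le_k : 1 ≤ k
  q : Fin (k + 1) → ℝ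
  strictMono : StrictMono q
  q_zero : q 0 = 0
  q_last : q (Fin.last k) = a

/-- The step `Δ_j = q_{j+1} - q_j`. -/
def IntervalPartition.step {a : ℝ} (Q : IntervalPartition a) (j : Fin Q.k) : ℝ :=
  Q.q j.succ - Q.q j.castSucc

/-- The norm `|Q|`: the largest step. -/
noncomputable def IntervalPartition.norm {a : ℝ} (Q : IntervalPartition a) : ℝ :=
  ⨆ j, Q.step j

/-- One Euler step from the enclosure `β` at time `p = q_j`, with `Δ = q_{j+1} - q_j`, evaluated
at time `x ∈ (q_j, q_{j+1}]`:
`T_K [β + ∫_p^x u(β) + (t - p) (u' · u)(T_K (β ⊕ M Δ)) dt]`. -/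
noncomputable def eulerStep {n : ℕ} {K M M₁ : ℝ} (hK : 0 < K)
    (u : BoxDom (Fin n) K → BoxDom (Fin n) M)
    (u' : BoxDom (Fin n) K → BoxDom (Fin n × Fin n) M₁)
    (p Δ : ℝ) (β : BoxDom (Fin n) K) (x : ℝ) : BoxDom (Fin n) K :=
  let A : BoxDom (Fin n) K := truncBox hK (symExpand β.box (M * Δ))
  truncBox hK fun i => β.box i + intervalValuedIntegral
    (fun t => (u β).box i + intervalScale (t - p) (intervalMulVec (u' A).box (u A).box i)) p x

/-- The enclosures at the partition points: `{0}` at `q_0`, then one Euler step after another. -/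
noncomputable def eulerNode {n : ℕ} {K M M₁ a : ℝ} (hK : 0 < K)
    (u : BoxDom (Fin n) K → BoxDom (Fin n) M)
    (u' : BoxDom (Fin n) K → BoxDom (Fin n × Fin n) M₁) (Q : IntervalPartition a) :
    Fin (Q.k + 1) → BoxDom (Fin n) K :=
  Fin.induction (truncBox hK 0)
    (fun j β => eulerStep hK u u' (Q.q j.castSucc) (Q.step j) β (Q.q j.succ))

open Classical in
/-- The enclosure `E²_{(u,u')}(Q) : [0, a] → I[-K, K]^n`: the value is `{0}` at time `0`, and on
`(q_j, q_{j+1}]` it is the Euler step from the enclosure at `q_j`. (At times outside `[0, a]`,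
which play no role, the value is the bottom element `[-K, K]^n`.) -/
noncomputable def euler2 {n : ℕ} {K M M₁ a : ℝ} (hK : 0 < K)
    (u : BoxDom (Fin n) K → BoxDom (Fin n) M)
    (u' : BoxDom (Fin n) K → BoxDom (Fin n × Fin n) M₁) (Q : IntervalPartition a) (x : ℝ) :
    BoxDom (Fin n) K :=
  if x = 0 then truncBox hK 0
  else if h : ∃ j : Fin Q.k, Q.q j.castSucc < x ∧ x ≤ Q.q j.succ then
    eulerStep hK u u' (Q.q h.choose.castSucc) (Q.step h.choose)
      (eulerNode hK u u' Q h.choose.castSucc) x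
  else truncBox hK (symExpand 0 K)

theorem euler2_zero {n : ℕ} {K M M₁ a : ℝ} (hK : 0 < K)
    (u : BoxDom (Fin n) K → BoxDom (Fin n) M)
    (u' : BoxDom (Fin n) K → BoxDom (Fin n × Fin n) M₁) (Q : IntervalPartition a) :
    euler2 hK u u' Q 0 = truncBox hK 0 := by
  simp [euler2]

theorem IntervalPartition.index_unique {a : ℝ} (Q : IntervalPartition a) {x : ℝ} {i j : Fin Q.k}
    (hi : Q.q i.castSucc < x ∧ x ≤ Q.q i.succ) (hj : Q.q j.castSucc < x ∧ x ≤ Q.q j.succ) :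
    i = j := by
  have h1 := Q.strictMono.lt_iff_lt.1 (hi.1.trans_le hj.2)
  have h2 := Q.strictMono.lt_iff_lt.1 (hj.1.trans_le hi.2)
  rw [Fin.lt_def] at h1 h2
  simp only [Fin.val_castSucc, Fin.val_succ] at h1 h2
  exact Fin.ext (by omega)

theorem euler2_of_mem_node {n : ℕ} {K M M₁ a : ℝ} (hK : 0 < K)
    (u : BoxDom (Fin n) K → BoxDom (Fin n) M)
    (u' : BoxDom (Fin n) K → BoxDom (Fin n × Fin n) M₁) (Q : IntervalPartition a)
    (j : Fin Q.k) {x : ℝ} (hx : Q.q j.castSucc < x ∧ x ≤ Q.q j.succ) :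
    euler2 hK u u' Q x = eulerStep hK u u' (Q.q j.castSucc) (Q.step j)
      (eulerNode hK u u' Q j.castSucc) x := by
  have h0 : (0 : ℝ) ≤ Q.q j.castSucc := Q.q_zero ▸ Q.strictMono.monotone (Fin.zero_le _)
  have hne : x ≠ 0 := (h0.trans_lt hx.1).ne'
  have h : ∃ j : Fin Q.k, Q.q j.castSucc < x ∧ x ≤ Q.q j.succ := ⟨j, hx⟩
  have hj : h.choose = j := Q.index_unique h.choose_spec hx
  unfold euler2
  rw [if_neg hne, dif_pos h, hj]

theorem euler2_q {n : ℕ} {K M M₁ a : ℝ} (hK : 0 < K)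
    (u : BoxDom (Fin n) K → BoxDom (Fin n) M)
    (u' : BoxDom (Fin n) K → BoxDom (Fin n × Fin n) M₁) (Q : IntervalPartition a)
    (i : Fin (Q.k + 1)) : euler2 hK u u' Q (Q.q i) = eulerNode hK u u' Q i := by
  induction i using Fin.cases with
  | zero => rw [Q.q_zero, euler2_zero]; simp [eulerNode]
  | succ j =>
    rw [euler2_of_mem_node hK u u' Q j ⟨Q.strictMono Fin.castSucc_lt_succ, le_rfl⟩]
    simp [eulerNode]

/-- The recursive equation: on `(q_j, q_{j+1}]` the enclosure is the Euler step from its own value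
at `q_j`. With `euler2_zero` it determines the enclosure on `[0, a]`. -/
theorem euler2_of_mem {n : ℕ} {K M M₁ a : ℝ} (hK : 0 < K)
    (u : BoxDom (Fin n) K → BoxDom (Fin n) M)
    (u' : BoxDom (Fin n) K → BoxDom (Fin n × Fin n) M₁) (Q : IntervalPartition a)
    (j : Fin Q.k) {x : ℝ} (hx : Q.q j.castSucc < x ∧ x ≤ Q.q j.succ) :
    euler2 hK u u' Q x = eulerStep hK u u' (Q.q j.castSucc) (Q.step j)
      (euler2 hK u u' Q (Q.q j.castSucc)) x := by
  rw [euler2_of_mem_node hK u u' Q j hx, euler2_q]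

/-- The width `sup {w(y(x)) : x ∈ [0, a]}` of an interval function on `[0, a]`, possibly `∞`. -/
noncomputable def funWidth {ι : Type} {K : ℝ} (a : ℝ) (y : ℝ → BoxDom ι K) : EReal :=
  ⨆ x ∈ Set.Icc (0 : ℝ) a, ((boxWidth (y x).box : ℝ) : EReal)

/-! ## Widths of interval operations -/

/-! A recursion for widths suffices. Let `w` be the width at `q_j` and `h = x - q_j ≤ Δ`. Truncation
does not widen, so the new width is at most `w + h·w(u(β)) + (h²/2)·w((u'·u)(A))`, where `A` has
width at most `w + 2MΔ`. Boundedness of `u'` makes `u` interval Lipschitz with constant `n M₁`, and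
then `u'·u`, a product of bounded Lipschitz maps, is Lipschitz with `D = n(M₁·nM₁ + MΛ)`. The
first-order term sees only `β`, not the enlarged box, so the enlargement `2MΔ` enters with the
factor `h²/2` and costs only `D M h Δ²`. Thus `w' ≤ (1 + L h) w + E h |Q|²`
(`boxWidth_eulerStep_le`), and a discrete Gronwall argument (`gronwall_step`) sums these errors to
`E x exp(L x) |Q|²`. -/

theorem boxWidth_nonneg {ι : Type} (α : IntervalBox ι) : 0 ≤ boxWidth α :=
  Real.iSup_nonneg fun i => sub_nonneg.2 (α i).fst_le_snd

theorem length_le_boxWidth {ι : Type} [Finite ι] (α : IntervalBox ι) (i : ι) :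
    (α i).length ≤ boxWidth α :=
  le_ciSup (f := fun i => (α i).snd - (α i).fst) (Set.finite_range _).bddAbove i

/-- Nonnegativity of `c` covers an empty index type, where the real supremum is `0`. -/
theorem boxWidth_le {ι : Type} {α : IntervalBox ι} {c : ℝ} (hc : 0 ≤ c)
    (h : ∀ i, (α i).length ≤ c) : boxWidth α ≤ c :=
  Real.iSup_le h hc

theorem intervalNorm_nonneg (I : NonemptyInterval ℝ) : 0 ≤ intervalNorm I :=
  (abs_nonneg _).trans (le_max_left _ _)

theorem BoxDom.intervalNorm_le {ι : Type} {K : ℝ} (α : BoxDom ι K) (i : ι) :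
    intervalNorm (α.box i) ≤ K := by
  have h := α.mem_cube i
  have h' := (α.box i).fst_le_snd
  exact max_le (abs_le.2 ⟨h.1, h'.trans h.2⟩) (abs_le.2 ⟨h.1.trans h', h.2⟩)

theorem BoxDom.matrixNormInf_le {n : ℕ} {M₁ : ℝ} (hM₁ : 0 ≤ M₁)
    (A : BoxDom (Fin n × Fin n) M₁) : matrixNormInf A.box ≤ n * M₁ := by
  refine Real.iSup_le (fun i => ?_) (by positivity)
  calc ∑ j, intervalNorm (A.box (i, j)) ≤ ∑ _j : Fin n, M₁ :=
        Finset.sum_le_sum fun j _ => A.intervalNorm_le _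
    _ = n * M₁ := by simp

/-- Product rule: `s t - s' t' = s (t - t') + t' (s - s')` for any end-points. -/
theorem length_intervalMul_le (I J : NonemptyInterval ℝ) :
    (intervalMul I J).length ≤
      intervalNorm I * J.length + intervalNorm J * I.length := by
  have key : ∀ s s' t t' : ℝ, |s| ≤ intervalNorm I → |t'| ≤ intervalNorm J →
      |s - s'| ≤ I.length → |t - t'| ≤ J.length →
      s * t ≤ s' * t' + (intervalNorm I * J.length + intervalNorm J * I.length) := by
    intro s s' t t' hs ht' hss htt
    have h1 : s * (t - t') ≤ intervalNorm I * J.length :=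
      (le_abs_self _).trans (by
        rw [abs_mul]
        exact mul_le_mul hs htt (abs_nonneg _) (intervalNorm_nonneg I))
    have h2 : t' * (s - s') ≤ intervalNorm J * I.length :=
      (le_abs_self _).trans (by
        rw [abs_mul]
        exact mul_le_mul ht' hss (abs_nonneg _) (intervalNorm_nonneg J))
    linarith
  have hI₁ : |I.fst| ≤ intervalNorm I := le_max_left _ _
  have hI₂ : |I.snd| ≤ intervalNorm I := le_max_right _ _
  have hJ₁ : |J.fst| ≤ intervalNorm J := le_max_left _ _
  have hJ₂ : |J.snd| ≤ intervalNorm J := le_max_right _ _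
  have diam : ∀ L : NonemptyInterval ℝ, |L.fst - L.fst| ≤ L.length ∧ |L.fst - L.snd| ≤ L.length ∧
      |L.snd - L.fst| ≤ L.length ∧ |L.snd - L.snd| ≤ L.length := by
    intro L
    have hL : |L.snd - L.fst| = L.length := abs_of_nonneg (sub_nonneg.2 L.fst_le_snd)
    simp [abs_sub_comm L.fst L.snd, hL]
  obtain ⟨i₁, i₂, i₃, i₄⟩ := diam I
  obtain ⟨j₁, j₂, j₃, j₄⟩ := diam J
  change max (max _ _) (max _ _) - min (min _ _) (min _ _) ≤ _
  -- Moving the constant inside the minima leaves sixteen comparisons of end-point products, each an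
  -- instance of `key`.
  rw [sub_le_iff_le_add', ← min_add_add_right, ← min_add_add_right, ← min_add_add_right]
  refine max_le (max_le ?_ ?_) (max_le ?_ ?_) <;>
    refine le_min (le_min ?_ ?_) (le_min ?_ ?_) <;>
    apply key <;> assumption

theorem length_intervalMulVec_le {n : ℕ} {M M₁ : ℝ} (hM : 0 ≤ M) (hM₁ : 0 ≤ M₁)
    (A : BoxDom (Fin n × Fin n) M₁) (v : BoxDom (Fin n) M) (i : Fin n) :
    (intervalMulVec A.box v.box i).length ≤ n * (M₁ * boxWidth v.box + M * boxWidth A.box) := by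
  unfold intervalMulVec
  rw [NonemptyInterval.length_sum]
  calc ∑ j, (intervalMul (A.box (i, j)) (v.box j)).length
      ≤ ∑ _j : Fin n, (M₁ * boxWidth v.box + M * boxWidth A.box) := by
        refine Finset.sum_le_sum fun j _ => (length_intervalMul_le _ _).trans ?_
        have := (v.box j).length_nonneg
        have := (A.box (i, j)).length_nonneg
        gcongr
        · exact A.intervalNorm_le _
        · exact length_le_boxWidth _ _
        · exact v.intervalNorm_le _
        · exact length_le_boxWidth _ _
    _ = _ := by simp [mul_add]

theorem intervalScale_fst {r : ℝ} (hr : 0 ≤ r) (I : NonemptyInterval ℝ) :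
    (intervalScale r I).fst = r * I.fst := by
  simp [intervalScale, intervalMul, mul_le_mul_of_nonneg_left I.fst_le_snd hr]

theorem intervalScale_snd {r : ℝ} (hr : 0 ≤ r) (I : NonemptyInterval ℝ) :
    (intervalScale r I).snd = r * I.snd := by
  simp [intervalScale, intervalMul, mul_le_mul_of_nonneg_left I.fst_le_snd hr]

theorem integral_add_sub_mul (c d p x : ℝ) :
    ∫ t in p..x, (c + (t - p) * d) = (x - p) * c + (x - p) ^ 2 / 2 * d := by
  rw [intervalIntegral.integral_add (by simp) (by apply Continuous.intervalIntegrable; fun_prop),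
    intervalIntegral.integral_mul_const,
    intervalIntegral.integral_comp_sub_right (fun t => t) p, integral_id]
  simp

/-- For `t ≥ p` scaling by `t - p` keeps the end-points in order, so both end-point functions are
affine in `t` and integrate explicitly. -/
theorem length_intervalValuedIntegral_affine (I J : NonemptyInterval ℝ) {p x : ℝ} (hpx : p ≤ x) :
    (intervalValuedIntegral (fun t => I + intervalScale (t - p) J) p x).length =
      (x - p) * I.length + (x - p) ^ 2 / 2 * J.length := by
  have h₁ : ∫ t in p..x, (I + intervalScale (t - p) J).fst =
      (x - p) * I.fst + (x - p) ^ 2 / 2 * J.fst := by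
    rw [← integral_add_sub_mul]
    refine intervalIntegral.integral_congr fun t ht => ?_
    rw [Set.uIcc_of_le hpx] at ht
    simp [intervalScale_fst (sub_nonneg.2 ht.1)]
  have h₂ : ∫ t in p..x, (I + intervalScale (t - p) J).snd =
      (x - p) * I.snd + (x - p) ^ 2 / 2 * J.snd := by
    rw [← integral_add_sub_mul]
    refine intervalIntegral.integral_congr fun t ht => ?_
    rw [Set.uIcc_of_le hpx] at ht
    simp [intervalScale_snd (sub_nonneg.2 ht.1)]
  have hx : 0 ≤ x - p := sub_nonneg.2 hpx
  have hle : (x - p) * I.fst + (x - p) ^ 2 / 2 * J.fst ≤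
      (x - p) * I.snd + (x - p) ^ 2 / 2 * J.snd := by
    have := I.fst_le_snd
    have := J.fst_le_snd
    gcongr
  simp only [NonemptyInterval.length, intervalValuedIntegral, h₁, h₂, max_eq_right hle,
    min_eq_left hle]
  ring

/-- Clamping is monotone and 1-Lipschitz. The box need not meet the cube, so it never has to be
shown that truncation is harmless. -/
theorem length_truncBox_le {ι : Type} {K : ℝ} (hK : 0 < K) (α : IntervalBox ι) (i : ι) :
    ((truncBox hK α).box i).length ≤ (α i).length := by
  have h := (α i).fst_le_snd
  simp only [NonemptyInterval.length, truncBox]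
  rw [sub_le_iff_le_add]
  refine max_le ?_ ?_
  · linarith [le_max_left (-K) (min K (α i).fst)]
  · have h' := le_max_right (-K) (min K (α i).fst)
    rcases le_total K (α i).fst with hc | hc
    · rw [min_eq_left hc] at h' ⊢
      linarith [min_le_left K (α i).snd]
    · rw [min_eq_right hc] at h' ⊢
      linarith [min_le_right K (α i).snd]

theorem boxWidth_truncBox_symExpand_le {ι : Type} [Finite ι] {K : ℝ} (hK : 0 < K)
    (α : IntervalBox ι) {r : ℝ} (hr : 0 ≤ r) :
    boxWidth (truncBox hK (symExpand α r)).box ≤ boxWidth α + 2 * r := by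
  have h0 := boxWidth_nonneg α
  refine boxWidth_le (by positivity) fun i => (length_truncBox_le hK _ i).trans ?_
  have h := length_le_boxWidth α i
  simp only [NonemptyInterval.length, symExpand, abs_of_nonneg hr] at h ⊢
  linarith

theorem boxWidth_truncBox_zero {ι : Type} {K : ℝ} (hK : 0 < K) :
    boxWidth (truncBox hK (0 : IntervalBox ι)).box = 0 :=
  le_antisymm (boxWidth_le le_rfl fun i => (length_truncBox_le hK _ i).trans (by simp))
    (boxWidth_nonneg _)

/-! ## The error of the second-order Euler operator -/

/-- The local error estimate: over one step the width grows by a factor `1 + O(h)` and a term of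
third order. -/
theorem boxWidth_eulerStep_le {n : ℕ} {K M M₁ Λ : ℝ} (hK : 0 < K) (hM : 0 ≤ M) (hM₁ : 0 ≤ M₁)
    (hΛ : 0 ≤ Λ) {u : BoxDom (Fin n) K → BoxDom (Fin n) M}
    {u' : BoxDom (Fin n) K → BoxDom (Fin n × Fin n) M₁}
    (hu : IntervalLipschitzWith (n * M₁) u) (hu' : IntervalLipschitzWith Λ u')
    (β : BoxDom (Fin n) K) {p x Δ : ℝ} (hpx : p ≤ x) (hxΔ : x - p ≤ Δ) (hΔ : Δ ≤ 1) :
    boxWidth (eulerStep hK u u' p Δ β x).box ≤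
      (1 + (n * M₁ + n * (M₁ * (n * M₁) + M * Λ)) * (x - p)) * boxWidth β.box +
        n * (M₁ * (n * M₁) + M * Λ) * M * (x - p) * Δ ^ 2 := by
  set h := x - p with hh
  set D := n * (M₁ * (n * M₁) + M * Λ) with hD
  have hh0 : 0 ≤ h := sub_nonneg.2 hpx
  have hΔ0 : 0 ≤ Δ := hh0.trans hxΔ
  have hD0 : 0 ≤ D := by positivity
  have hw := boxWidth_nonneg β.box
  refine boxWidth_le (by positivity) fun i => (length_truncBox_le hK _ i).trans ?_
  rw [NonemptyInterval.length_add, length_intervalValuedIntegral_affine _ _ hpx, ← hh]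
  set A : BoxDom (Fin n) K := truncBox hK (symExpand β.box (M * Δ))
  have hA : boxWidth A.box ≤ boxWidth β.box + 2 * (M * Δ) :=
    boxWidth_truncBox_symExpand_le hK _ (by positivity)
  have hmul : (intervalMulVec (u' A).box (u A).box i).length ≤
      D * (boxWidth β.box + 2 * (M * Δ)) := by
    calc _ ≤ n * (M₁ * boxWidth (u A).box + M * boxWidth (u' A).box) :=
          length_intervalMulVec_le hM hM₁ _ _ i
      _ ≤ n * (M₁ * (n * M₁ * boxWidth A.box) + M * (Λ * boxWidth A.box)) := by
          gcongr
          · exact hu A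
          · exact hu' A
      _ = D * boxWidth A.box := by rw [hD]; ring
      _ ≤ _ := by gcongr
  -- Two ways to spend `h²`: `h Δ` gives the third-order error, while `h² / 2 ≤ h`, from `Δ ≤ 1`,
  -- absorbs the quadratic multiple of `w` into the growth factor.
  have hsq : h ^ 2 ≤ h * Δ := by rw [sq]; gcongr
  have hsq' : h ^ 2 / 2 ≤ h := by nlinarith
  calc (β.box i).length + (h * ((u β).box i).length +
        h ^ 2 / 2 * (intervalMulVec (u' A).box (u A).box i).length)
      ≤ boxWidth β.box + (h * (n * M₁ * boxWidth β.box) +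
          h ^ 2 / 2 * (D * (boxWidth β.box + 2 * (M * Δ)))) := by
        gcongr
        · exact length_le_boxWidth _ _
        · exact (length_le_boxWidth _ _).trans (hu β)
    _ = (1 + n * M₁ * h) * boxWidth β.box + h ^ 2 / 2 * (D * boxWidth β.box) +
          h ^ 2 * (D * (M * Δ)) := by ring
    _ ≤ (1 + n * M₁ * h) * boxWidth β.box + h * (D * boxWidth β.box) +
          h * Δ * (D * (M * Δ)) := by gcongr
    _ = _ := by ring

/-! ### Accumulation of the local errors along the partition -/

/-- The bound `E q exp(L q)` replaces the sharper `E (exp(L q) - 1) / L`, avoiding division by `L`,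
which may vanish. -/
theorem gronwall_step {L E q h w w' N : ℝ} (hL : 0 ≤ L) (hE : 0 ≤ E) (hq : 0 ≤ q) (hh : 0 ≤ h)
    (hw : w ≤ E * q * Real.exp (L * q) * N ^ 2)
    (hw' : w' ≤ (1 + L * h) * w + E * h * N ^ 2) :
    w' ≤ E * (q + h) * Real.exp (L * (q + h)) * N ^ 2 := by
  have h1 : 1 + L * h ≤ Real.exp (L * h) := by
    linarith [Real.add_one_le_exp (L * h)]
  have h2 : 1 ≤ Real.exp (L * (q + h)) := Real.one_le_exp (by positivity)
  calc w' ≤ (1 + L * h) * w + E * h * N ^ 2 := hw'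
    _ ≤ (1 + L * h) * (E * q * Real.exp (L * q) * N ^ 2) + E * h * N ^ 2 := by gcongr
    _ ≤ Real.exp (L * h) * (E * q * Real.exp (L * q) * N ^ 2) +
          Real.exp (L * (q + h)) * (E * h * N ^ 2) := by
        exact add_le_add (mul_le_mul_of_nonneg_right h1 (by positivity))
          (le_mul_of_one_le_left (by positivity) h2)
    _ = _ := by rw [mul_add L, Real.exp_add]; ring

theorem IntervalPartition.step_le_norm {a : ℝ} (Q : IntervalPartition a) (j : Fin Q.k) :
    Q.step j ≤ Q.norm :=
  le_ciSup (f := Q.step) (Set.finite_range _).bddAbove j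

theorem IntervalPartition.q_nonneg {a : ℝ} (Q : IntervalPartition a) (i : Fin (Q.k + 1)) :
    0 ≤ Q.q i :=
  Q.q_zero ▸ Q.strictMono.monotone (Fin.zero_le i)

theorem IntervalPartition.exists_mem_step {a : ℝ} (Q : IntervalPartition a) {x : ℝ} (h0 : 0 < x)
    (hx : x ≤ a) : ∃ j : Fin Q.k, Q.q j.castSucc < x ∧ x ≤ Q.q j.succ := by
  have key : ∀ i : Fin (Q.k + 1), x ≤ Q.q i →
      ∃ j : Fin Q.k, Q.q j.castSucc < x ∧ x ≤ Q.q j.succ := by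
    intro i
    induction i using Fin.induction with
    | zero => intro h; exact absurd (Q.q_zero ▸ h) h0.not_ge
    | succ j ih =>
      intro h
      rcases lt_or_ge (Q.q j.castSucc) x with hj | hj
      · exact ⟨j, hj, h⟩
      · exact ih hj
  exact key (Fin.last _) (Q.q_last.symm ▸ hx)

/-- The second-order error estimate at every time of `[0, a]`. -/
theorem boxWidth_euler2_le {n : ℕ} {K M M₁ Λ a : ℝ} (hK : 0 < K) (hM : 0 ≤ M) (hM₁ : 0 ≤ M₁)
    (hΛ : 0 ≤ Λ) {u : BoxDom (Fin n) K → BoxDom (Fin n) M}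
    {u' : BoxDom (Fin n) K → BoxDom (Fin n × Fin n) M₁}
    (hu : IntervalLipschitzWith (n * M₁) u) (hu' : IntervalLipschitzWith Λ u')
    {L E : ℝ} (hL : L = n * M₁ + n * (M₁ * (n * M₁) + M * Λ))
    (hE : E = n * (M₁ * (n * M₁) + M * Λ) * M)
    (Q : IntervalPartition a) (hQ : Q.norm ≤ 1) {x : ℝ} (hx : x ∈ Set.Icc 0 a) :
    boxWidth (euler2 hK u u' Q x).box ≤ E * x * Real.exp (L * x) * Q.norm ^ 2 := by
  have hL0 : 0 ≤ L := by rw [hL]; positivity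
  have hE0 : 0 ≤ E := by rw [hE]; positivity
  -- Stated for every `y` in the step, so that it serves both the induction over nodes and the final
  -- partial step. There the elapsed time may be shorter than the full step that fixes the
  -- enlargement.
  have advance : ∀ (j : Fin Q.k) (y : ℝ), Q.q j.castSucc < y ∧ y ≤ Q.q j.succ →
      boxWidth (euler2 hK u u' Q (Q.q j.castSucc)).box ≤
        E * Q.q j.castSucc * Real.exp (L * Q.q j.castSucc) * Q.norm ^ 2 →
      boxWidth (euler2 hK u u' Q y).box ≤ E * y * Real.exp (L * y) * Q.norm ^ 2 := by
    intro j y hy ih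
    have hstep : y - Q.q j.castSucc ≤ Q.step j := sub_le_sub_right hy.2 _
    have hh : 0 ≤ y - Q.q j.castSucc := sub_nonneg.2 hy.1.le
    have hj := Q.step_le_norm j
    have hj0 : 0 ≤ Q.step j := hh.trans hstep
    have h := boxWidth_eulerStep_le hK hM hM₁ hΛ hu hu'
      (euler2 hK u u' Q (Q.q j.castSucc)) hy.1.le hstep (hj.trans hQ)
    rw [← euler2_of_mem hK u u' Q j hy, ← hL, ← hE] at h
    have h' := gronwall_step hL0 hE0 (Q.q_nonneg _) hh ih (h.trans (by gcongr))
    rwa [add_sub_cancel] at h'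
  have start : boxWidth (euler2 hK u u' Q 0).box = 0 := by
    rw [euler2_zero, boxWidth_truncBox_zero]
  have node : ∀ i : Fin (Q.k + 1), boxWidth (euler2 hK u u' Q (Q.q i)).box ≤
      E * Q.q i * Real.exp (L * Q.q i) * Q.norm ^ 2 := by
    intro i
    induction i using Fin.induction with
    | zero => rw [Q.q_zero, start]; simp
    | succ j ih => exact advance j _ ⟨Q.strictMono Fin.castSucc_lt_succ, le_rfl⟩ ih
  rcases hx.1.eq_or_lt with rfl | h0
  · rw [start]; simp
  · obtain ⟨j, hj⟩ := Q.exists_mem_step h0 hx.2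
    exact advance j x hj (node _)

theorem mainTheorem4 (n : ℕ) (hn : 1 ≤ n) (K M M₁ a : ℝ) (hK : 0 < K) (hM : 0 < M) (hM₁ : 0 ≤ M₁)
    (ha : 0 < a) (haK : a ≤ K / (M * (1 + n * M₁)))
    (f : (Fin n → ℝ) → (Fin n → ℝ)) (hf : Set.MapsTo f (cube (Fin n) K) (cube (Fin n) M))
    (u : BoxDom (Fin n) K → BoxDom (Fin n) M) (hu : ScottContinuous u)
    (u' : BoxDom (Fin n) K → BoxDom (Fin n × Fin n) M₁) (hu' : ScottContinuous u')
    (hext : IsIntervalExtension u (fun x => {f x}))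
    (hext' : IsIntervalExtension u' (Lbar (cube (Fin n) K) f))
    (hwidth : ∀ α : BoxDom (Fin n) K,
      boxWidth (u α).box ≤ matrixNormInf (u' α).box * boxWidth α.box)
    (hLip : ∃ Λ : ℝ, 0 ≤ Λ ∧ IntervalLipschitzWith Λ u') :
    ∃ C : ℝ, 0 ≤ C ∧ ∀ Q : IntervalPartition a, Q.norm ≤ 1 →
      funWidth a (euler2 hK u u' Q) ≤ ((C * Q.norm ^ 2 : ℝ) : EReal) := by
  obtain ⟨Λ, hΛ, hLip⟩ := hLip
  have hLipu : IntervalLipschitzWith (n * M₁) u := fun α =>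
    (hwidth α).trans
      (mul_le_mul_of_nonneg_right (BoxDom.matrixNormInf_le hM₁ _) (boxWidth_nonneg _))
  set L : ℝ := n * M₁ + n * (M₁ * (n * M₁) + M * Λ) with hL
  set E : ℝ := n * (M₁ * (n * M₁) + M * Λ) * M with hE
  have hL0 : 0 ≤ L := by positivity
  have hE0 : 0 ≤ E := by positivity
  -- The pointwise bound increases with `x`, so its value at `a` works for all partitions.
  refine ⟨E * a * Real.exp (L * a), by positivity, fun Q hQ => iSup₂_le fun x hx => ?_⟩
  refine EReal.coe_le_coe_iff.2
    ((boxWidth_euler2_le hK hM.le hM₁ hΛ hLipu hLip hL hE Q hQ hx).trans ?_)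
  have hx0 := hx.1
  gcongr
  · exact hx.2
  · exact hx.2
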